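/- **Setting.** Let $H$ be a finite simple connected graph with a set $S$ of sources and a non-empty set $T_H$ of targets. The cutting procedure on $H$ is the random sequence $H=H_0\supsetneq H_1\supsetneq\dots$ in which $H_{i+1}$ arises from $H_i\neq\emptyset$ by removing a uniformly random vertex of $H_i$ (chosen independently of the past) and then keeping only those connected components that contain a source; the procedure stops when the graph is empty. Let $\mathfrak S=\inf\{i\ge 0: V(H_i)\cap T_H=\emptyset\}$ and let $H_{\mathfrak S}$ be the random graph at that time. An induced subgraph $A$ of $H$ (identified with its vertex set) is admissible if $\mathbf P[H_{\mathfrak S}=A]>0$; $\mathscr A_m(H)$ denotes the set of admissible subgraphs with exactly $m$ vertices. For a vertex set $A$ of a graph, $\partial_S A$ denotes the set of vertices of that graph that are not in $A$ and that lie in $S$ or have a neighbour in $A$. **Theorem 4.8.** Let $G$ be a locally finite, infinite, connected graph with subsets $S,T\subseteq V(G)$, and let $(G^{(n)})_{n\ge1}$ be finite connected induced subgraphs exhausting $G$, that is, $G^{(1)}\subseteq G^{(2)}\subseteq\cdots$, $\bigcup_n V(G^{(n)})=V(G)$, and $S\subseteq V(G^{(n)})$ for all $n$. Endow $G^{(n)}$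 with the source set $S$ and the target set $T^{(n)}=(T\cap V(G^{(n)}))\cup\{v\in V(G^{(n)}): v \text{ has a neighbour in } V(G)\setminus V(G^{(n)})\}$. Put $$a_{m,n}=\sum_{A\in\mathscr A_m(G^{(n)})}|\partial_S A|,$$ with boundaries taken in $G^{(n)}$. Then the limit $a_m=\lim_{n\to\infty}a_{m,n}$ exists and is finite for every $m\ge0$. Assume moreover that there are a real number $b>0$ and an integer $L\ge0$ such that 1. $|\partial_S A|\ge bm+1$ for all $n$, all $m\ge L$ and all $A\in\mathscr A_m(G^{(n)})$; 2. the power series $f(x)=\sum_{m=L}^\infty a_m x^m$ has radius of convergence at least $\dfrac{b^b}{(b+1)^{b+1}}$ and satisfies $\displaystyle\int_0^1 f\big(x(1-x)^b\big)\,dx<\infty$. Then the sizes $|G^{(n)}_{\mathfrak S}|$ of the separation graphs form a tight family of random variables: for every $\varepsilon>0$ there is an $M$ with $\mathbf P\big[|G^{(n)}_{\mathfrak S}|\ge M\big]<\varepsilon$ for all $n$. -/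

import Mathlib

open Filter Topology MeasureTheory

/-! Induced subgraphs of a graph `G` on `V` are identified with their vertex sets. Finite induced
subgraphs are given by a `Finset V`; the set of sources is `S` and the set of targets is `T`. -/

namespace Separation

variable {V : Type*}

/-- The exterior boundary `∂_S A = clos_S(A) \ A` of `A`, computed in the induced subgraph `G[W]`:
the vertices of `G[W]` not in `A` that are sources or have a neighbour in `A`. -/
def boundary (G : SimpleGraph V) (W S A : Set V) : Set V :=
  {v | v ∈ W ∧ v ∉ A ∧ (v ∈ S ∨ ∃ w ∈ A, G.Adj v w)}

/-- The vertices of `G[B]` whose connected component in `G[B]` contains a source, i.e. that are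
joined to a source by a walk of `G` staying in `B`. -/
def rooted (G : SimpleGraph V) (S B : Set V) : Set V :=
  {w | ∃ s ∈ S, ∃ p : G.Walk s w, ∀ u ∈ p.support, u ∈ B}

open scoped Classical in
/-- One cut: remove `v` from `G[A]` and keep only the components containing sources. -/
noncomputable def cutStep (G : SimpleGraph V) (S : Set V) (A : Finset V) (v : V) : Finset V :=
  (A.erase v).filter fun w => w ∈ rooted G S (A.erase v : Finset V)

theorem card_cutStep_lt (G : SimpleGraph V) (S : Set V) (A : Finset V) {v : V} (hv : v ∈ A) :
    (cutStep G S A v).card < A.card := by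
  classical
  unfold cutStep
  refine lt_of_le_of_lt (Finset.card_filter_le _ _) ?_
  convert Finset.card_erase_lt_of_mem hv

/-- The sequence `A, g 0, g 1, …`. -/
def prepend (A : Finset V) (g : ℕ → Finset V) : ℕ → Finset V
  | 0 => A
  | i + 1 => g i

open scoped Classical in
/-- The law of the cutting procedure `G_0, G_1, G_2, …` started from the finite graph `G_0 = G[A]`:
as long as the current graph is nonempty, a uniformly random vertex of it is cut, independently of
the past; once the graph is empty it stays empty. -/
noncomputable def cutProcess (G : SimpleGraph V) (S : Set V) (A : Finset V) :
    PMF (ℕ → Finset V) :=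
  if hA : A.Nonempty then
    haveI : Nonempty A := hA.to_subtype
    (PMF.uniformOfFintype A).bind fun v =>
      (cutProcess G S (cutStep G S A v)).map (prepend A)
  else PMF.pure fun _ => ∅
termination_by A.card
decreasing_by exact card_cutStep_lt G S A v.2

/-- The separation number: the number of cuts until no target is left. -/
noncomputable def sepNumber (T : Set V) (g : ℕ → Finset V) : ℕ :=
  sInf {i | ∀ v ∈ g i, v ∉ T}

/-- The law of the separation subgraph, i.e. of `G_𝔖` with `𝔖` the separation number,
for the cutting procedure on the finite graph `G[W]`. -/
noncomputable def sepGraphLaw (G : SimpleGraph V) (S T : Set V) (W : Finset V) :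
    PMF (Finset V) :=
  (cutProcess G S W).map fun g => g (sepNumber T g)

/-- The law of the (real-valued) random variable `|G_𝔖|` for the finite graph `G[W]`. -/
noncomputable def sepSizeLaw (G : SimpleGraph V) (S T : Set V) (W : Finset V) : Measure ℝ :=
  ((sepGraphLaw G S T W).map fun A => (A.card : ℝ)).toMeasure

open scoped Classical in
/-- The set `𝒜_m(G[W])` of admissible subgraphs of size `m`: the induced subgraphs of `G[W]` with
`m` vertices that are equal to the separation subgraph with positive probability. -/
noncomputable def admissible (G : SimpleGraph V) (S T : Set V) (W : Finset V) (m : ℕ) :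
    Finset (Finset V) :=
  (W.powersetCard m).filter fun A => 0 < sepGraphLaw G S T W A

/-- A sequence `W 0 ⊆ W 1 ⊆ …` of finite connected induced subgraphs exhausts `G` (with set of
sources `S`). The target sets of the subgraphs are given by `targets`. -/
structure Exhausts (G : SimpleGraph V) (S : Set V) (W : ℕ → Finset V) : Prop where
  connected : ∀ n, (G.induce (W n : Set V)).Connected
  mono : Monotone W
  union : ⋃ n, (W n : Set V) = Set.univ
  sources : ∀ n, S ⊆ W n

/-- The target set of the finite induced subgraph `G[W]`: the targets of `G` in `W`, together with
the exterior boundary in `G` of the complement of `W`. -/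
def targets (G : SimpleGraph V) (T : Set V) (W : Finset V) : Set V :=
  (T ∩ W) ∪ boundary G Set.univ ∅ (W : Set V)ᶜ

/-- The total boundary count `∑_{A ∈ 𝒜_m(G[W])} |∂_S A|`, where `G[W]` carries the target set
`targets G T W` and boundaries are taken in `G[W]`. -/
noncomputable def boundaryCount (G : SimpleGraph V) (S T : Set V) (W : Finset V) (m : ℕ) : ℕ :=
  ∑ A ∈ admissible G S (targets G T W) W m, (boundary G W S A).ncard

/-- The limiting boundary count `a_m = lim_n a_{m,n}`. -/
noncomputable def boundaryCountLim (G : SimpleGraph V) (S T : Set V) (W : ℕ → Finset V)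
    (m : ℕ) : ℝ :=
  limUnder atTop fun n => (boundaryCount G S T (W n) m : ℝ)

/-- The coefficients of the power series `∑_{m ≥ L} a_m x^m`. -/
def tailCoeff (a : ℕ → ℝ) (L : ℕ) (m : ℕ) : ℝ :=
  if L ≤ m then a m else 0

end Separation

/-!
Give the vertices independent uniform clocks and cut each vertex when its clock rings; the
jump chain is the cutting procedure. A set `A` whose vertices are joined to sources inside `A`
occurs in it exactly when the clocks on `∂_S A` all ring before those on `A`. So with `m = |A|` and
`k = |∂_S A|` the separation subgraph is `A` with probability at most `1 / (m + k).choose m`. For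
`k ≥ b m + 1` this equals `∫₀¹ k (1 - x)^(k - 1) x^m dx`, which is at most
`k ∫₀¹ (x (1 - x)^b)^m dx`. Summing over the admissible `A` with `m` vertices
turns the factor `k` into `a_{m,n}`, so that `P[|G_𝔖| > M]` is bounded by a tail of the series
`∑ a_m ∫₀¹ (x (1 - x)^b)^m dx`, provided that `a_{m,n} ≤ a_m`. This series converges by the
integrability hypothesis, and its terms do not depend on `n`. The clocks do not appear in the
formal proof: the bound `sepGraphLaw_le` is an induction along the recursion `sepGraphLaw_apply`,
which conditions on the first cut.

Both the existence of `a_m` and the inequality `a_{m,n} ≤ a_m` come from `boundaryCount_mono`: the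
sequence `a_{m,n}` is nondecreasing in `n`. Indeed, if there are sources at all,
then a subgraph is admissible if and only if each of its vertices is joined to a source inside it
and it contains no target (`sepGraphLaw_ne_zero_iff`). A subgraph of `G[W n]` without targets has no neighbours outside `W n`,
so enlarging `W n` changes neither its admissibility nor its boundary. The sequence is bounded since
an admissible subgraph with `m` vertices lies in the ball of radius `m` around the finite set of
sources.
-/

namespace Separation

variable {V : Type*}

/-! ### The recursion for the law of the separation subgraph -/

section Law

variable (G : SimpleGraph V) (S T : Set V)

/-- Almost surely the process starts at `B` and dies out, so that the infimum in `sepNumber` is taken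
over a nonempty set. -/
theorem cutProcess_support (B : Finset V) :
    ∀ g ∈ (cutProcess G S B).support, g 0 = B ∧ ∃ i, g i = ∅ := by
  classical
  induction hn : B.card using Nat.strong_induction_on generalizing B with
  | _ n ih =>
    intro g hg
    rw [cutProcess] at hg
    split_ifs at hg with hB
    · rw [PMF.mem_support_bind_iff] at hg
      obtain ⟨v, -, hg⟩ := hg
      rw [PMF.mem_support_map_iff] at hg
      obtain ⟨f, hf, rfl⟩ := hg
      obtain ⟨-, i, hi⟩ := ih _ (hn ▸ card_cutStep_lt G S B v.2) _ rfl f hf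
      exact ⟨rfl, i + 1, hi⟩
    · rw [PMF.mem_support_pure_iff] at hg
      subst hg
      exact ⟨(Finset.not_nonempty_iff_eq_empty.1 hB).symm, 0, rfl⟩

theorem sepNumber_prepend (B : Finset V) (hB : ∃ t ∈ B, t ∈ T) (g : ℕ → Finset V)
    (hg : ∃ i, g i = ∅) : sepNumber T (prepend B g) = sepNumber T g + 1 := by
  obtain ⟨i, hi⟩ := hg
  obtain ⟨t, htB, htT⟩ := hB
  have hne : {i | ∀ v ∈ g i, v ∉ T}.Nonempty := ⟨i, fun v hv => by simp [hi] at hv⟩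
  refine le_antisymm (Nat.sInf_le fun v hv => Nat.sInf_mem hne v hv) ?_
  refine le_csInf ⟨i + 1, fun v hv => by simp [prepend, hi] at hv⟩ fun k hk => ?_
  cases k with
  | zero => exact absurd htT (hk t htB)
  | succ k => exact Nat.succ_le_succ (Nat.sInf_le hk)

theorem sepGraphLaw_of_no_target (B : Finset V) (hB : ∀ t ∈ B, t ∉ T) :
    sepGraphLaw G S T B = PMF.pure B := by
  have h : ∀ g ∈ (cutProcess G S B).support, g (sepNumber T g) = B := by
    intro g hg
    have h0 := (cutProcess_support G S B g hg).1
    have : sepNumber T g = 0 := Nat.sInf_eq_zero.2 (Or.inl (by simpa [h0] using hB))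
    rw [this, h0]
  refine PMF.ext fun A => ?_
  by_cases hA : A = B
  · subst hA
    rw [PMF.pure_apply, if_pos rfl, PMF.apply_eq_one_iff]
    refine subset_antisymm ?_ ?_
    · intro C hC
      rw [sepGraphLaw, PMF.mem_support_map_iff] at hC
      obtain ⟨g, hg, rfl⟩ := hC
      exact h g hg
    · intro C hC
      rw [Set.mem_singleton_iff.1 hC]
      obtain ⟨g, hg⟩ := (cutProcess G S A).support_nonempty
      rw [sepGraphLaw, PMF.mem_support_map_iff]
      exact ⟨g, hg, h g hg⟩
  · rw [PMF.pure_apply, if_neg hA, PMF.apply_eq_zero_iff, sepGraphLaw, PMF.mem_support_map_iff]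
    rintro ⟨g, hg, rfl⟩
    exact hA (h g hg)

/-- As long as targets are left, the separation subgraph is found by cutting a uniformly random
vertex and starting afresh. -/
theorem sepGraphLaw_apply (B : Finset V) (hB : ∃ t ∈ B, t ∈ T) (A : Finset V) :
    sepGraphLaw G S T B A =
      (B.card : ENNReal)⁻¹ * ∑ v ∈ B, sepGraphLaw G S T (cutStep G S B v) A := by
  classical
  have hne : B.Nonempty := hB.imp fun t ht => ht.1
  have : Nonempty B := hne.to_subtype
  have hlaw : sepGraphLaw G S T B = (PMF.uniformOfFintype B).bind fun v =>
      sepGraphLaw G S T (cutStep G S B v) := by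
    rw [sepGraphLaw, cutProcess, dif_pos hne, PMF.map_bind]
    congr 1
    funext v
    rw [PMF.map_comp, sepGraphLaw]
    rw [← PMF.bind_pure_comp, ← PMF.bind_pure_comp]
    refine PMF.ext fun C => ?_
    rw [PMF.bind_apply, PMF.bind_apply]
    refine tsum_congr fun g => ?_
    by_cases hg : g ∈ (cutProcess G S (cutStep G S B v)).support
    · have := sepNumber_prepend T B hB g (cutProcess_support G S _ g hg).2
      simp only [Function.comp, this, prepend]
    · rw [(PMF.apply_eq_zero_iff _ _).2 hg, zero_mul, zero_mul]
  rw [hlaw, PMF.bind_apply, tsum_fintype, ← Finset.sum_coe_sort B, Finset.mul_sum]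
  simp [PMF.uniformOfFintype_apply]

end Law

/-! ### Rooted sets and the effect of one cut -/

section Rooted

variable {G : SimpleGraph V} {S : Set V}

theorem rooted_mono {B C : Set V} (h : B ⊆ C) : rooted G S B ⊆ rooted G S C := by
  rintro w ⟨s, hs, p, hp⟩
  exact ⟨s, hs, p, fun u hu => h (hp u hu)⟩

theorem rooted_of_walk {B : Set V} {v w : V} (hv : v ∈ rooted G S B) (p : G.Walk v w)
    (hp : ∀ u ∈ p.support, u ∈ B) : w ∈ rooted G S B := by
  obtain ⟨s, hs, q, hq⟩ := hv
  refine ⟨s, hs, q.append p, fun u hu => ?_⟩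
  rcases (SimpleGraph.Walk.mem_support_append_iff q p).1 hu with h | h
  exacts [hq u h, hp u h]

theorem rooted_of_source {B : Set V} {v : V} (hvS : v ∈ S) (hvB : v ∈ B) :
    v ∈ rooted G S B :=
  ⟨v, hvS, .nil, by simpa using hvB⟩

theorem rooted_of_adj {B : Set V} {v w : V} (hv : v ∈ rooted G S B) (h : G.Adj v w)
    (hw : w ∈ B) : w ∈ rooted G S B := by
  have hvB : v ∈ B := by
    obtain ⟨s, -, q, hq⟩ := hv
    exact hq v q.end_mem_support
  exact rooted_of_walk hv (.cons h .nil) (by simp [hvB, hw])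

/-- Every vertex of the exterior boundary of a rooted set is rooted. -/
theorem rooted_of_mem_boundary {A B C : Set V} (hA : A ⊆ rooted G S A) (hAC : A ⊆ C)
    {v : V} (hv : v ∈ boundary G B S A) (hvC : v ∈ C) : v ∈ rooted G S C := by
  obtain ⟨-, -, hvS | ⟨w, hw, hadj⟩⟩ := hv
  · exact rooted_of_source hvS hvC
  · exact rooted_of_adj (rooted_mono hAC (hA hw)) hadj.symm hvC

theorem mem_cutStep {B : Finset V} {v w : V} :
    w ∈ cutStep G S B v ↔ w ∈ rooted G S ((B : Set V) \ {v}) := by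
  classical
  have h : ((B.erase v : Finset V) : Set V) = (B : Set V) \ {v} := Finset.coe_erase v B
  unfold cutStep
  rw [Finset.mem_filter]
  constructor
  · rintro ⟨-, hw⟩
    rw [← h]
    convert hw
  · intro hw
    have hw' := hw
    obtain ⟨s, -, p, hp⟩ := hw'
    have := hp w p.end_mem_support
    refine ⟨?_, ?_⟩
    · have := Finset.mem_erase.2 ⟨this.2, Finset.mem_coe.1 this.1⟩
      convert this
    · rw [← h] at hw
      convert hw

theorem mem_of_mem_cutStep {B : Finset V} {v w : V} (hw : w ∈ cutStep G S B v) :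
    w ∈ B ∧ w ≠ v := by
  obtain ⟨s, -, p, hp⟩ := mem_cutStep.1 hw
  exact hp w p.end_mem_support

theorem notMem_cutStep (B : Finset V) (v : V) : v ∉ cutStep G S B v :=
  fun h => (mem_of_mem_cutStep h).2 rfl

theorem cutStep_rooted (B : Finset V) (v : V) :
    (cutStep G S B v : Set V) ⊆ rooted G S (cutStep G S B v : Set V) := by
  classical
  intro w hw
  obtain ⟨s, hs, p, hp⟩ := mem_cutStep.1 hw
  refine ⟨s, hs, p, fun u hu => mem_cutStep.2 ⟨s, hs, p.takeUntil u hu, fun x hx => ?_⟩⟩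
  exact hp x (p.support_takeUntil_subset_support hu hx)

theorem subset_cutStep {A B : Finset V} (hA : (A : Set V) ⊆ rooted G S A) (hAB : A ⊆ B)
    {v : V} (hv : v ∉ A) : A ⊆ cutStep G S B v := by
  intro w hw
  refine mem_cutStep.2 (rooted_mono ?_ (hA hw))
  exact fun u hu => ⟨hAB hu, fun h => hv (h ▸ hu)⟩

theorem boundary_cutStep {A B : Finset V} (hA : (A : Set V) ⊆ rooted G S A) (hAB : A ⊆ B)
    {v : V} (hv : v ∉ A) :
    boundary G (cutStep G S B v) S A = boundary G B S A \ {v} := by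
  classical
  ext u
  constructor
  · rintro ⟨h1, h2, h3⟩
    have := mem_of_mem_cutStep h1
    exact ⟨⟨this.1, h2, h3⟩, this.2⟩
  · rintro ⟨hu, huv⟩
    refine ⟨mem_cutStep.2 (rooted_of_mem_boundary hA ?_ hu ⟨hu.1, huv⟩), hu.2⟩
    exact fun w hw => ⟨hAB hw, fun h => hv (h ▸ hw)⟩

theorem boundary_finite (A : Set V) (B : Finset V) : (boundary G B S A).Finite :=
  B.finite_toSet.subset fun _ h => h.1

/-- A walk that starts in `A`, stays in `B` and avoids the boundary of `A` in `B` ends in `A`. -/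
theorem mem_of_walk_avoiding_boundary {A B : Set V} {v w : V} (p : G.Walk v w) (hv : v ∈ A)
    (hp : ∀ u ∈ p.support, u ∈ B \ boundary G B S A) : w ∈ A := by
  induction p with
  | nil => exact hv
  | @cons x y z h p ih =>
    refine ih ?_ (fun u hu => hp u (by simp [hu]))
    by_contra hy
    have := hp y (by simp)
    exact this.2 ⟨this.1, hy, Or.inr ⟨x, hv, h.symm⟩⟩

/-- If the boundary of `A` in `B` is the single vertex `v`, then cutting `v` leaves exactly `A`. -/
theorem cutStep_eq_of_boundary_eq {A B : Finset V} (hA : (A : Set V) ⊆ rooted G S A)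
    (hAB : A ⊆ B) {v : V} (hv : boundary G B S (A : Set V) = {v}) : cutStep G S B v = A := by
  have hvA : v ∉ A := (hv.symm ▸ Set.mem_singleton v : v ∈ boundary G B S (A : Set V)).2.1
  refine Finset.Subset.antisymm (fun w hw => ?_) (subset_cutStep hA hAB hvA)
  obtain ⟨s, hs, p, hp⟩ := mem_cutStep.1 hw
  rw [← hv] at hp
  refine mem_of_walk_avoiding_boundary (S := S) p ?_ hp
  by_contra hsA
  have := hp s p.start_mem_support
  exact this.2 ⟨this.1, hsA, Or.inl hs⟩

/-- A walk in `B` that ends outside `A` either misses `A` and its boundary, or has a final segment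
that starts on the boundary of `A` and never returns there. -/
theorem exists_last_boundary {A B : Set V} {x t : V} (p : G.Walk x t)
    (hp : ∀ u ∈ p.support, u ∈ B) (ht : t ∉ A) :
    (∀ u ∈ p.support, u ∉ A ∧ u ∉ boundary G B S A) ∨
      ∃ v ∈ boundary G B S A, ∃ q : G.Walk v t,
        ∀ u ∈ q.support, u ∈ B ∧ (u ∈ boundary G B S A → u = v) := by
  induction p with
  | @nil x =>
    by_cases hx : x ∈ boundary G B S A
    · refine Or.inr ⟨x, hx, .nil, fun u hu => ?_⟩
      have hux : u = x := by simpa using hu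
      exact ⟨hux ▸ hx.1, fun _ => hux⟩
    · refine Or.inl fun u hu => ?_
      have hux : u = x := by simpa using hu
      exact hux ▸ ⟨ht, hx⟩
  | @cons x y z h p ih =>
    rcases ih (fun u hu => hp u (by simp [hu])) ht with ih | ih
    · by_cases hx : x ∈ boundary G B S A
      · refine Or.inr ⟨x, hx, .cons h p, fun u hu => ⟨hp u hu, fun hub => ?_⟩⟩
        rcases List.mem_cons.1 (by simpa using hu : u ∈ x :: p.support) with h' | h'
        · exact h'
        · exact absurd hub (ih u h').2
      · have hy := ih y p.start_mem_support
        have hyB : y ∈ B := hp y (by simp)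
        refine Or.inl fun u hu => ?_
        rcases List.mem_cons.1 (by simpa using hu : u ∈ x :: p.support) with h' | h'
        · subst h'
          exact ⟨fun hxA => hy.2 ⟨hyB, hy.1, Or.inr ⟨_, hxA, h.symm⟩⟩, hx⟩
        · exact ih u h'
    · exact Or.inr ih

end Rooted

/-! ### Admissible subgraphs -/

section Admissible

variable {G : SimpleGraph V} {S T : Set V}

/-- The alternative `A = B` accounts for the initial graph, which is not pruned: its components need
not contain sources. -/
theorem subset_of_sepGraphLaw_ne_zero (B A : Finset V) (h : sepGraphLaw G S T B A ≠ 0) :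
    A ⊆ B ∧ (∀ t ∈ A, t ∉ T) ∧ (A = B ∨ (A : Set V) ⊆ rooted G S A) := by
  classical
  induction hn : B.card using Nat.strong_induction_on generalizing B with
  | _ n ih =>
    by_cases hB : ∃ t ∈ B, t ∈ T
    · rw [sepGraphLaw_apply G S T B hB] at h
      obtain ⟨v, hv, hne⟩ := Finset.exists_ne_zero_of_sum_ne_zero (right_ne_zero_of_mul h)
      obtain ⟨h1, h2, h3⟩ := ih _ (hn ▸ card_cutStep_lt G S B hv) _ hne rfl
      refine ⟨fun w hw => (mem_of_mem_cutStep (h1 hw)).1, h2, Or.inr ?_⟩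
      rcases h3 with h3 | h3
      · rw [h3]
        exact cutStep_rooted B v
      · exact h3
    · push Not at hB
      rw [sepGraphLaw_of_no_target G S T B hB, PMF.pure_apply] at h
      have hAB : A = B := by
        by_contra hAB
        exact h (if_neg hAB)
      exact ⟨hAB.subset, hAB ▸ hB, Or.inl hAB⟩

theorem rooted_of_sepGraphLaw_ne_zero {B A : Finset V} (hB : ∃ t ∈ B, t ∈ T)
    (h : sepGraphLaw G S T B A ≠ 0) : (A : Set V) ⊆ rooted G S A := by
  obtain ⟨-, h2, h3⟩ := subset_of_sepGraphLaw_ne_zero B A h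
  rcases h3 with h3 | h3
  · obtain ⟨t, htB, htT⟩ := hB
    exact absurd htT (h2 t (h3 ▸ htB))
  · exact h3

/-- A rooted target-free `A` is the separation subgraph with positive probability: take a walk from
a source to a target and its last visit `v` to the boundary of `A`; cut all boundary vertices other
than `v`, which leaves the target reachable, and then `v`. -/
theorem sepGraphLaw_pos {A : Finset V} (hA : (A : Set V) ⊆ rooted G S A)
    (hAT : ∀ t ∈ A, t ∉ T) (B : Finset V) (hB : (B : Set V) ⊆ rooted G S B) (hAB : A ⊆ B)
    (hBT : ∃ t ∈ B, t ∈ T) : 0 < sepGraphLaw G S T B A := by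
  classical
  induction hn : B.card using Nat.strong_induction_on generalizing B with
  | _ n ih =>
    suffices ∃ v ∈ B, 0 < sepGraphLaw G S T (cutStep G S B v) A by
      obtain ⟨v, hv, hpos⟩ := this
      rw [sepGraphLaw_apply G S T B hBT]
      refine ENNReal.mul_pos (by simp) (ne_of_gt (lt_of_lt_of_le hpos ?_))
      exact Finset.single_le_sum (f := fun v => sepGraphLaw G S T (cutStep G S B v) A)
        (fun _ _ => zero_le) hv
    obtain ⟨t, htB, htT⟩ := hBT
    have htA : t ∉ (A : Set V) := fun h => hAT t h htT
    obtain ⟨s, hs, p, hp⟩ := hB htB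
    rcases exists_last_boundary (S := S) p hp htA with h | ⟨v, hv, q, hq⟩
    · have h' := h s p.start_mem_support
      exact absurd ⟨hp s p.start_mem_support, h'.1, Or.inl hs⟩ h'.2
    by_cases hu : ∃ u ∈ boundary G B S (A : Set V), u ≠ v
    · obtain ⟨u, hu, huv⟩ := hu
      have huA : u ∉ A := hu.2.1
      refine ⟨u, hu.1, ih _ (hn ▸ card_cutStep_lt G S B hu.1) _ (cutStep_rooted B u)
        (subset_cutStep hA hAB huA) ⟨t, ?_, htT⟩ rfl⟩
      refine mem_cutStep.2 (rooted_of_walk (rooted_of_mem_boundary hA ?_ hv ⟨hv.1, huv.symm⟩) q ?_)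
      · exact fun w hw => ⟨hAB hw, fun h => huA (h ▸ hw)⟩
      · exact fun w hw => ⟨(hq w hw).1, fun h => huv ((hq u (h ▸ hw)).2 hu)⟩
    · push Not at hu
      have hbd : boundary G B S (A : Set V) = {v} :=
        Set.Subset.antisymm hu (Set.singleton_subset_iff.2 hv)
      refine ⟨v, hv.1, ?_⟩
      rw [cutStep_eq_of_boundary_eq hA hAB hbd, sepGraphLaw_of_no_target G S T A hAT]
      simp

/-- If the vertices carry independent uniform clocks, then a rooted `A` with `k` boundary vertices
occurs in the cutting procedure only if all clocks on the boundary ring before those on `A`, which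
has probability `1 / (|A| + k).choose |A|`. -/
theorem sepGraphLaw_le {A : Finset V} (hA : (A : Set V) ⊆ rooted G S A) (B : Finset V)
    (hAB : A ⊆ B) :
    (sepGraphLaw G S T B A).toReal ≤
      ((A.card + (boundary G B S (A : Set V)).ncard).choose A.card : ℝ)⁻¹ := by
  classical
  induction hn : B.card using Nat.strong_induction_on generalizing B with
  | _ n ih =>
    by_cases hBT : ∃ t ∈ B, t ∈ T
    swap
    · push Not at hBT
      rw [sepGraphLaw_of_no_target G S T B hBT, PMF.pure_apply]
      split_ifs with hAB'
      · have : boundary G B S (A : Set V) = ∅ := by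
          rw [hAB']
          exact Set.eq_empty_of_forall_notMem fun v hv => hv.2.1 hv.1
        simp [this]
      · simp
    set D : Finset V := (boundary_finite (G := G) (S := S) (A : Set V) B).toFinset with hD
    have hDmem : ∀ v, v ∈ D ↔ v ∈ boundary G B S (A : Set V) := fun v => by simp [hD]
    set m := A.card with hm
    have hk : (boundary G B S (A : Set V)).ncard = D.card :=
      Set.ncard_eq_toFinset_card _ _
    rw [hk]
    set k := D.card with hkD
    -- `q j` bounds the probability when `j` boundary vertices are left.
    set q : ℕ → ℝ := fun j => ((m + j).choose m : ℝ)⁻¹ with hq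
    have hBpos : (0 : ℝ) < B.card := by
      obtain ⟨t, ht, -⟩ := hBT
      exact_mod_cast Finset.card_pos.2 ⟨t, ht⟩
    have hDA : Disjoint A D :=
      Finset.disjoint_left.2 fun v hvA hvD => ((hDmem v).1 hvD).2.1 hvA
    have hADB : A ∪ D ⊆ B :=
      Finset.union_subset hAB fun v hv => ((hDmem v).1 hv).1
    have hcard : (B \ (A ∪ D)).card = (B.card : ℝ) - (m + k) := by
      have h1 := Finset.card_sdiff_add_card_eq_card hADB
      rw [Finset.card_union_of_disjoint hDA] at h1
      have : ((B \ (A ∪ D)).card : ℝ) + (m + k) = B.card := by exact_mod_cast h1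
      linarith
    have hsum : ∑ v ∈ B, (sepGraphLaw G S T (cutStep G S B v) A).toReal =
        ∑ v ∈ B \ (A ∪ D), (sepGraphLaw G S T (cutStep G S B v) A).toReal +
        (∑ v ∈ A, (sepGraphLaw G S T (cutStep G S B v) A).toReal +
          ∑ v ∈ D, (sepGraphLaw G S T (cutStep G S B v) A).toReal) := by
      rw [← Finset.sum_union hDA, Finset.sum_sdiff hADB]
    -- Cutting a vertex of `A` rules `A` out, cutting a boundary vertex lowers `k` by one, and any
    -- other cut leaves the boundary as it is.
    have hA0 : ∑ v ∈ A, (sepGraphLaw G S T (cutStep G S B v) A).toReal = 0 := by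
      refine Finset.sum_eq_zero fun v hv => ?_
      have : sepGraphLaw G S T (cutStep G S B v) A = 0 := by
        by_contra h
        exact notMem_cutStep B v ((subset_of_sepGraphLaw_ne_zero _ _ h).1 hv)
      rw [this, ENNReal.toReal_zero]
    have hstep : ∀ v ∈ B, v ∉ A → (sepGraphLaw G S T (cutStep G S B v) A).toReal ≤
        q (boundary G B S (A : Set V) \ {v}).ncard := fun v hvB hvA => by
      have := ih _ (hn ▸ card_cutStep_lt G S B hvB) _ (subset_cutStep hA hAB hvA) rfl
      rwa [boundary_cutStep hA hAB hvA] at this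
    have hD0 : ∑ v ∈ D, (sepGraphLaw G S T (cutStep G S B v) A).toReal ≤ k * q (k - 1) := by
      rw [← nsmul_eq_mul]
      refine Finset.sum_le_card_nsmul _ _ _ fun v hv => ?_
      have hv' := (hDmem v).1 hv
      refine (hstep v hv'.1 hv'.2.1).trans_eq ?_
      rw [Set.ncard_sdiff_singleton_of_mem hv', hk]
    have hR : ∑ v ∈ B \ (A ∪ D), (sepGraphLaw G S T (cutStep G S B v) A).toReal ≤
        ((B.card : ℝ) - (m + k)) * q k := by
      rw [← hcard, ← nsmul_eq_mul]
      refine Finset.sum_le_card_nsmul _ _ _ fun v hv => ?_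
      simp only [Finset.mem_sdiff, Finset.mem_union, not_or, hDmem] at hv
      refine (hstep v hv.1 hv.2.1).trans_eq ?_
      rw [Set.sdiff_singleton_eq_self hv.2.2, hk]
    -- For `k = 0` the truncated `k - 1` is harmless because of the factor `k`; for `k > 0` this is
    -- an equality, and it makes the induction close.
    have hrec : (k : ℝ) * q (k - 1) ≤ (m + k) * q k := by
      rcases Nat.eq_zero_or_pos k with h0 | hpos
      · rw [h0]
        simp only [hq]
        simp
      · obtain ⟨j, hj⟩ : ∃ j, k = j + 1 := ⟨k - 1, by omega⟩
        have h1 : ((m + (j + 1)).choose m : ℝ) * (j + 1) = (m + j).choose m * (m + (j + 1)) := by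
          have := Nat.add_one_mul_choose_eq (m + j) j
          have h2 := Nat.choose_symm_add (a := m) (b := j)
          have h3 := Nat.choose_symm_add (a := m) (b := j + 1)
          rw [h2, h3]
          have h4 : (m + (j + 1)).choose (j + 1) * (j + 1) =
            (m + j).choose j * (m + (j + 1)) := by
            rw [mul_comm ((m + j).choose j)]
            exact this.symm
          exact_mod_cast h4
        have h2 : (0 : ℝ) < ((m + (j + 1)).choose m : ℝ) := by
          exact_mod_cast Nat.choose_pos (by omega)
        have h3 : (0 : ℝ) < ((m + j).choose m : ℝ) := by
          exact_mod_cast Nat.choose_pos (by omega)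
        rw [hj]
        simp only [hq, Nat.add_sub_cancel]
        push_cast
        rw [← div_eq_mul_inv, ← div_eq_mul_inv, div_le_div_iff₀ h3 h2]
        linarith
    rw [sepGraphLaw_apply G S T B hBT, ENNReal.toReal_mul, ENNReal.toReal_inv,
      ENNReal.toReal_natCast, ENNReal.toReal_sum fun v _ => PMF.apply_ne_top _ _,
      inv_mul_le_iff₀ hBpos, hsum, hA0]
    linarith

end Admissible

/-! ### The Beta integral -/

/-- The Beta integral `B(j + 1, m + 1)` at natural parameters, normalized by `j + 1`. -/
theorem integral_beta_nat (j m : ℕ) :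
    ∫ x in (0 : ℝ)..1, ((j : ℝ) + 1) * ((1 - x) ^ j * x ^ m) =
      ((m + (j + 1)).choose m : ℝ)⁻¹ := by
  induction m generalizing j with
  | zero =>
    have hd : ∀ x ∈ Set.uIcc (0 : ℝ) 1, HasDerivAt (fun x : ℝ => -(1 - x) ^ (j + 1))
        (((j : ℝ) + 1) * ((1 - x) ^ j * x ^ 0)) x := by
      intro x _
      convert! (((hasDerivAt_id x).const_sub 1).pow (j + 1)).neg using 1
      simp
    rw [intervalIntegral.integral_eq_sub_of_hasDerivAt hd
      (by apply Continuous.intervalIntegrable; fun_prop)]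
    simp
  | succ m ih =>
    -- Integrating the derivative of a product that vanishes at both ends relates `(j, m + 1)` to
    -- `(j + 1, m)`.
    have hd : ∀ x ∈ Set.uIcc (0 : ℝ) 1,
        HasDerivAt (fun x : ℝ => (1 - x) ^ (j + 1) * x ^ (m + 1))
        (-(((j : ℝ) + 1) * ((1 - x) ^ j * x ^ (m + 1))) +
          ((m : ℝ) + 1) / ((j : ℝ) + 2) *
            (((j + 1 : ℕ) : ℝ) + 1) * ((1 - x) ^ (j + 1) * x ^ m)) x := by
      intro x _
      convert! (((hasDerivAt_id x).const_sub 1).pow (j + 1)).mul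
        ((hasDerivAt_id x).pow (m + 1)) using 1
      have : ((j : ℝ) + 2) ≠ 0 := by positivity
      simp
      field_simp
      ring
    have h := intervalIntegral.integral_eq_sub_of_hasDerivAt hd
      (by apply Continuous.intervalIntegrable; fun_prop)
    rw [intervalIntegral.integral_add (by apply Continuous.intervalIntegrable; fun_prop)
      (by apply Continuous.intervalIntegrable; fun_prop), intervalIntegral.integral_neg] at h
    simp only [mul_assoc, intervalIntegral.integral_const_mul] at h ih ⊢
    rw [ih (j + 1)] at h
    have hc : ((m + 1 + (j + 1)).choose (m + 1) : ℝ) * (m + 1) =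
        ((m + (j + 1 + 1)).choose m : ℝ) * (j + 2) := by
      have := Nat.choose_succ_right_eq (m + (j + 2)) m
      rw [show m + (j + 2) - m = j + 2 by omega] at this
      rw [show m + 1 + (j + 1) = m + (j + 2) by ring]
      exact_mod_cast this
    have h1 : (0 : ℝ) < ((m + 1 + (j + 1)).choose (m + 1) : ℝ) := by
      exact_mod_cast Nat.choose_pos (by omega)
    have h2 : (0 : ℝ) < ((m + (j + 1 + 1)).choose m : ℝ) := by
      exact_mod_cast Nat.choose_pos (by omega)
    simp at h
    have h3 : ((m : ℝ) + 1) / (j + 2) * ((m + (j + 1 + 1)).choose m : ℝ)⁻¹ =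
        ((m + 1 + (j + 1)).choose (m + 1) : ℝ)⁻¹ := by
      field_simp
      linarith
    linarith

theorem inv_choose_le_lintegral {b : ℝ} (hb : 0 < b) {m k : ℕ} (hk : b * m + 1 ≤ (k : ℝ)) :
    ENNReal.ofReal (((m + k).choose m : ℝ)⁻¹) ≤
      k * ∫⁻ x in Set.Icc (0 : ℝ) 1, ENNReal.ofReal ((x * (1 - x) ^ b) ^ m) := by
  obtain ⟨j, rfl⟩ : ∃ j, k = j + 1 := by
    refine Nat.exists_eq_succ_of_ne_zero ?_
    rintro rfl
    have : 0 ≤ b * m := by positivity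
    simp at hk
    linarith
  have hj : b * m ≤ j := by push_cast at hk; linarith
  rw [← integral_beta_nat, intervalIntegral.integral_of_le zero_le_one,
    ← integral_Icc_eq_integral_Ioc, ofReal_integral_eq_lintegral_ofReal, ← lintegral_const_mul']
  · refine setLIntegral_mono' measurableSet_Icc fun x hx => ?_
    have hx1 : 0 ≤ 1 - x := by linarith [hx.2]
    rw [ENNReal.ofReal_mul (by positivity)]
    refine mul_le_mul' (le_of_eq (by rw [← ENNReal.ofReal_natCast]; push_cast; rfl)) ?_
    refine ENNReal.ofReal_le_ofReal ?_
    rw [mul_pow, mul_comm, ← Real.rpow_mul_natCast hx1, ← Real.rpow_natCast (1 - x) j]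
    exact mul_le_mul_of_nonneg_left (Real.rpow_le_rpow_of_exponent_ge' hx1 (by linarith [hx.1])
      (by positivity) hj) (pow_nonneg hx.1 _)
  · exact ENNReal.natCast_ne_top _
  · apply Continuous.integrableOn_Icc; fun_prop
  · refine (ae_restrict_iff' measurableSet_Icc).2 (ae_of_all _ fun x hx => ?_)
    have hx1 : 0 ≤ 1 - x := by linarith [hx.2]
    have := hx.1
    simp only [Pi.zero_apply]
    positivity

/-! ### Exhaustions and the boundary counts -/

section Exhaustion

variable {G : SimpleGraph V} {S T : Set V}

theorem mem_targets {B : Finset V} {v : V} :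
    v ∈ targets G T B ↔ v ∈ B ∧ (v ∈ T ∨ ∃ w, w ∉ B ∧ G.Adj v w) := by
  simp only [targets, boundary, Set.mem_union, Set.mem_inter_iff, Finset.mem_coe,
    Set.mem_ofPred_eq, Set.mem_univ, true_and, Set.mem_compl_iff, not_not, Set.mem_empty_iff_false,
    false_or]
  tauto

theorem mem_admissible {B A : Finset V} {m : ℕ} :
    A ∈ admissible G S T B m ↔ A.card = m ∧ sepGraphLaw G S T B A ≠ 0 := by
  classical
  simp only [admissible, Finset.mem_filter, Finset.mem_powersetCard, pos_iff_ne_zero]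
  exact ⟨fun h => ⟨h.1.2, h.2⟩,
    fun h => ⟨⟨(subset_of_sepGraphLaw_ne_zero _ _ h.2).1, h.1⟩, h.2⟩⟩

theorem subset_rooted_of_connected {B : Finset V} (hB : (G.induce (B : Set V)).Connected)
    (hS : S.Nonempty) (hSB : S ⊆ B) : (B : Set V) ⊆ rooted G S B := by
  intro w hw
  obtain ⟨s, hs⟩ := hS
  obtain ⟨p⟩ := hB.preconnected ⟨s, hSB hs⟩ ⟨w, hw⟩
  refine ⟨s, hs, p.map (SimpleGraph.Embedding.induce (B : Set V)).toHom, fun u hu => ?_⟩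
  obtain ⟨x, -, rfl⟩ := List.mem_map.1
    ((congrArg (u ∈ ·) (SimpleGraph.Walk.support_map _ p)).mp hu)
  exact x.2

/-- A finite part of an infinite connected graph has a vertex with a neighbour outside, which is a
target by definition. -/
theorem exists_mem_targets [Infinite V] (hG : G.Connected) {B : Finset V} (hB : B.Nonempty) :
    ∃ t ∈ B, t ∈ targets G T B := by
  obtain ⟨u, hu⟩ := hB
  obtain ⟨v, hv⟩ := Infinite.exists_notMem_finset B
  obtain ⟨p⟩ := hG.preconnected u v
  obtain ⟨d, -, h1, h2⟩ := p.exists_boundary_dart (B : Set V) hu hv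
  exact ⟨d.fst, h1, mem_targets.2 ⟨h1, Or.inr ⟨d.snd, h2, d.adj⟩⟩⟩

/-- If every vertex of `B` is joined to a source in `B` and `B` contains a target, then the
admissible subgraphs are exactly the rooted subgraphs without targets. -/
theorem sepGraphLaw_ne_zero_iff {B A : Finset V} (hB : (B : Set V) ⊆ rooted G S B)
    (hBT : ∃ t ∈ B, t ∈ T) : sepGraphLaw G S T B A ≠ 0 ↔
      A ⊆ B ∧ (∀ t ∈ A, t ∉ T) ∧ (A : Set V) ⊆ rooted G S A := by
  refine ⟨fun h => ?_, fun h => (sepGraphLaw_pos h.2.2 h.2.1 B hB h.1 hBT).ne'⟩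
  obtain ⟨h1, h2, -⟩ := subset_of_sepGraphLaw_ne_zero _ _ h
  exact ⟨h1, h2, rooted_of_sepGraphLaw_ne_zero hBT h⟩

/-- A set without targets has no neighbours outside the finite graph, so its boundary does not
depend on the finite graph it is computed in. -/
theorem boundary_eq_of_no_target {A B C : Finset V} (hBC : B ⊆ C) (hSB : S ⊆ B) (hAB : A ⊆ B)
    (hA : ∀ t ∈ A, t ∉ targets G T B) :
    boundary G C S (A : Set V) = boundary G B S (A : Set V) := by
  ext v
  refine ⟨fun hv => ⟨?_, hv.2⟩, fun hv => ⟨hBC hv.1, hv.2⟩⟩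
  rcases hv.2.2 with h | ⟨w, hw, hadj⟩
  · exact hSB h
  · by_contra hvB
    exact hA w hw (mem_targets.2 ⟨hAB hw, Or.inr ⟨v, hvB, hadj.symm⟩⟩)

/-- Admissible subgraphs stay admissible, with the same boundary, when the finite graph grows. -/
theorem boundaryCount_mono [Infinite V] (hG : G.Connected) {W : ℕ → Finset V}
    (hW : Exhausts G S W) (m : ℕ) : Monotone fun n => boundaryCount G S T (W n) m := by
  intro n n' hnn'
  have hne : ∀ n, (W n).Nonempty := fun n => by
    obtain ⟨x⟩ := (hW.connected n).nonempty
    exact ⟨x, x.2⟩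
  have htar := fun n => exists_mem_targets (T := T) hG (hne n)
  have hsub := hW.mono hnn'
  rcases S.eq_empty_or_nonempty with hS | hS
  · -- Without sources only the empty graph is admissible, and its boundary is empty.
    refine (Finset.sum_eq_zero fun A hA => ?_).trans_le (Nat.zero_le _)
    have hr := rooted_of_sepGraphLaw_ne_zero (htar n) (mem_admissible.1 hA).2
    have hA0 : ∀ v, v ∉ A := fun v hv => by
      obtain ⟨s, hs, -⟩ := hr hv
      simp [hS] at hs
    rw [Set.ncard_eq_zero (boundary_finite _ _)]
    refine Set.eq_empty_of_forall_notMem fun v hv => ?_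
    rcases hv.2.2 with h | ⟨w, hw, -⟩
    · simp [hS] at h
    · exact hA0 w hw
  · have hroot := fun n => subset_rooted_of_connected (hW.connected n) hS (hW.sources n)
    have key : ∀ A ∈ admissible G S (targets G T (W n)) (W n) m,
        A ∈ admissible G S (targets G T (W n')) (W n') m ∧
        boundary G (W n') S (A : Set V) = boundary G (W n) S (A : Set V) := by
      intro A hA
      obtain ⟨hm, hA⟩ := mem_admissible.1 hA
      obtain ⟨h1, h2, h3⟩ := (sepGraphLaw_ne_zero_iff (hroot n) (htar n)).1 hA
      refine ⟨mem_admissible.2 ⟨hm, (sepGraphLaw_ne_zero_iff (hroot n') (htar n')).2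
        ⟨h1.trans hsub, fun t ht htT => h2 t ht ?_, h3⟩⟩,
        boundary_eq_of_no_target hsub (hW.sources n) h1 h2⟩
      rw [mem_targets] at htT ⊢
      exact ⟨h1 ht, htT.2.imp_right fun ⟨w, hw, hadj⟩ => ⟨w, fun h => hw (hsub h), hadj⟩⟩
    calc ∑ A ∈ admissible G S (targets G T (W n)) (W n) m, (boundary G (W n) S (A : Set V)).ncard
        = ∑ A ∈ admissible G S (targets G T (W n)) (W n) m,
            (boundary G (W n') S (A : Set V)).ncard :=
          Finset.sum_congr rfl fun A hA => by rw [(key A hA).2]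
      _ ≤ _ := Finset.sum_le_sum_of_subset fun A hA => (key A hA).1

theorem finite_walk_ball (hfin : ∀ v, (G.neighborSet v).Finite) (hS : S.Finite) (r : ℕ) :
    {v | ∃ s ∈ S, ∃ p : G.Walk s v, p.length ≤ r}.Finite := by
  induction r with
  | zero =>
    refine hS.subset ?_
    rintro v ⟨s, hs, p, hp⟩
    exact SimpleGraph.Walk.eq_of_length_eq_zero (Nat.le_zero.1 hp) ▸ hs
  | succ r ih =>
    refine (hS.union (ih.biUnion fun v _ => hfin v)).subset ?_
    rintro v ⟨s, hs, p, hp⟩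
    rcases p.length.eq_zero_or_pos with h | h
    · exact Or.inl (SimpleGraph.Walk.eq_of_length_eq_zero h ▸ hs)
    · refine Or.inr (Set.mem_biUnion (x := p.penultimate) ⟨s, hs, p.dropLast, ?_⟩ ?_)
      · rw [SimpleGraph.Walk.length_dropLast]
        omega
      · exact p.adj_penultimate (SimpleGraph.Walk.not_nil_iff_lt_length.2 h)

/-- A rooted set lies in the ball around the sources whose radius is its cardinality. -/
theorem exists_walk_length_le_card {A : Finset V} (hA : (A : Set V) ⊆ rooted G S A) {v : V}
    (hv : v ∈ A) : ∃ s ∈ S, ∃ p : G.Walk s v, p.length ≤ A.card := by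
  classical
  obtain ⟨s, hs, p, hp⟩ := hA hv
  refine ⟨s, hs, p.bypass, ?_⟩
  have h1 : p.bypass.support.toFinset ⊆ A := fun u hu =>
    hp u (p.support_bypass_subset_support (List.mem_toFinset.1 hu))
  have h2 := Finset.card_le_card h1
  rw [List.toFinset_card_of_nodup p.bypass_isPath.support_nodup,
    SimpleGraph.Walk.length_support] at h2
  omega

theorem exists_boundaryCount_le [Infinite V] (hG : G.Connected)
    (hfin : ∀ v, (G.neighborSet v).Finite) {W : ℕ → Finset V} (hW : Exhausts G S W) (m : ℕ) :
    ∃ C, ∀ n, boundaryCount G S T (W n) m ≤ C := by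
  classical
  have hS : S.Finite := (W 0).finite_toSet.subset (hW.sources 0)
  set F := (finite_walk_ball hfin hS m).toFinset with hF
  have hN : (S ∪ ⋃ v ∈ F, G.neighborSet v).Finite :=
    hS.union (F.finite_toSet.biUnion fun v _ => hfin v)
  refine ⟨F.powerset.card * (S ∪ ⋃ v ∈ F, G.neighborSet v).ncard, fun n => ?_⟩
  obtain ⟨x⟩ := (hW.connected n).nonempty
  have htar := exists_mem_targets (T := T) hG ⟨x.1, x.2⟩
  have hAF : ∀ A ∈ admissible G S (targets G T (W n)) (W n) m, A ⊆ F := fun A hA v hv => by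
    obtain ⟨hm, hA⟩ := mem_admissible.1 hA
    rw [hF, Set.Finite.mem_toFinset, ← hm]
    exact exists_walk_length_le_card (rooted_of_sepGraphLaw_ne_zero htar hA) hv
  refine (Finset.sum_le_card_nsmul _ _ _ fun A hA => Set.ncard_le_ncard ?_ hN).trans
    (Nat.mul_le_mul_right _ (Finset.card_le_card fun A hA => Finset.mem_powerset.2 (hAF A hA)))
  rintro v ⟨-, -, h | ⟨w, hw, hadj⟩⟩
  · exact Or.inl h
  · exact Or.inr (Set.mem_biUnion (hAF A hA hw) hadj.symm)

theorem tendsto_boundaryCountLim [Infinite V] (hG : G.Connected)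
    (hfin : ∀ v, (G.neighborSet v).Finite) {W : ℕ → Finset V} (hW : Exhausts G S W) (m : ℕ) :
    Tendsto (fun n => (boundaryCount G S T (W n) m : ℝ)) atTop
      (𝓝 (boundaryCountLim G S T W m)) := by
  obtain ⟨C, hC⟩ := exists_boundaryCount_le (T := T) hG hfin hW m
  have hmono : Monotone fun n => (boundaryCount G S T (W n) m : ℝ) := fun n n' h =>
    Nat.cast_le.2 (boundaryCount_mono hG hW m h)
  refine tendsto_nhds_limUnder ⟨_, tendsto_atTop_ciSup hmono ⟨C, ?_⟩⟩
  rintro _ ⟨n, rfl⟩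
  exact Nat.cast_le.2 (hC n)

theorem boundaryCount_le_lim [Infinite V] (hG : G.Connected)
    (hfin : ∀ v, (G.neighborSet v).Finite) {W : ℕ → Finset V} (hW : Exhausts G S W) (m n : ℕ) :
    (boundaryCount G S T (W n) m : ℝ) ≤ boundaryCountLim G S T W m :=
  Monotone.ge_of_tendsto (fun _ _ h => Nat.cast_le.2 (boundaryCount_mono hG hW m h))
    (tendsto_boundaryCountLim hG hfin hW m) n

end Exhaustion

/-! ### Tail bounds for the size of the separation subgraph -/

section Tail

variable {G : SimpleGraph V} {S T : Set V}

theorem sum_admissible_le {B : Finset V} (hBT : ∃ t ∈ B, t ∈ T) {b : ℝ} (hb : 0 < b) {m : ℕ}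
    (hbd : ∀ A ∈ admissible G S T B m,
      b * m + 1 ≤ ((boundary G B S (A : Set V)).ncard : ℝ)) :
    ∑ A ∈ admissible G S T B m, sepGraphLaw G S T B A ≤
      (∑ A ∈ admissible G S T B m, (boundary G B S (A : Set V)).ncard : ℕ) *
        ∫⁻ x in Set.Icc (0 : ℝ) 1, ENNReal.ofReal ((x * (1 - x) ^ b) ^ m) := by
  rw [Nat.cast_sum, Finset.sum_mul]
  refine Finset.sum_le_sum fun A hA => ?_
  obtain ⟨hm, hA0⟩ := mem_admissible.1 hA
  refine le_trans ?_ (inv_choose_le_lintegral hb (hbd A hA))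
  rw [ENNReal.le_ofReal_iff_toReal_le (PMF.apply_ne_top _ _) (by positivity)]
  have := sepGraphLaw_le (T := T) (rooted_of_sepGraphLaw_ne_zero hBT hA0) B
    (subset_of_sepGraphLaw_ne_zero _ _ hA0).1
  rwa [hm] at this

theorem sepSizeLaw_compl_Icc_le (B : Finset V) (M : ℕ) :
    sepSizeLaw G S T B (Set.Icc 0 (M : ℝ))ᶜ ≤
      ∑' m, ∑ A ∈ admissible G S T B (m + M), sepGraphLaw G S T B A := by
  rw [sepSizeLaw, PMF.toMeasure_apply_eq_toOuterMeasure_apply _ measurableSet_Icc.compl,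
    PMF.toOuterMeasure_map_apply]
  calc _ ≤ (sepGraphLaw G S T B).toOuterMeasure
        (⋃ m, (admissible G S T B (m + M) : Set (Finset V))) := by
        refine PMF.toOuterMeasure_mono _ ?_
        rintro A ⟨hA, hA0⟩
        have hM : M < A.card := by
          by_contra h
          exact hA ⟨Nat.cast_nonneg _, Nat.cast_le.2 (not_lt.1 h)⟩
        refine Set.mem_iUnion.2 ⟨A.card - M, Finset.mem_coe.2 (mem_admissible.2 ⟨by omega, ?_⟩)⟩
        exact (PMF.mem_support_iff _ _).1 hA0
    _ ≤ _ := measure_iUnion_le _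
    _ = _ := tsum_congr fun m => PMF.toOuterMeasure_apply_finset _ _

end Tail

end Separation

open Separation in
theorem theorem4p8 {V : Type*} [Infinite V] (G : SimpleGraph V) (hG : G.Connected)
    (hfin : ∀ v, (G.neighborSet v).Finite) (S T : Set V) (W : ℕ → Finset V)
    (hW : Separation.Exhausts G S W) :
    -- the limits defining the coefficients exist
    (∀ m, Tendsto (fun n => (Separation.boundaryCount G S T (W n) m : ℝ)) atTop
      (𝓝 (Separation.boundaryCountLim G S T W m))) ∧
    ∀ (b : ℝ) (L : ℕ), 0 < b →
      (∀ n m, L ≤ m →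
        ∀ A ∈ Separation.admissible G S (Separation.targets G T (W n)) (W n) m,
          b * m + 1 ≤ ((Separation.boundary G (W n) S A).ncard : ℝ)) →
      ENNReal.ofReal (b ^ b / (b + 1) ^ (b + 1)) ≤
        (FormalMultilinearSeries.ofScalars ℝ
          (Separation.tailCoeff (Separation.boundaryCountLim G S T W) L)).radius →
      (∫⁻ x in Set.Icc (0 : ℝ) 1, ∑' m, ENNReal.ofReal
        (Separation.tailCoeff (Separation.boundaryCountLim G S T W) L m *
          (x * (1 - x) ^ b) ^ m)) < ⊤ →
      IsTightMeasureSet (Set.range fun n =>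
        Separation.sepSizeLaw G S (Separation.targets G T (W n)) (W n)) := by
  refine ⟨tendsto_boundaryCountLim hG hfin hW, fun b L hb hbd _ hint => ?_⟩
  set c := tailCoeff (boundaryCountLim G S T W) L with hc
  have hlim0 : ∀ m, 0 ≤ boundaryCountLim G S T W m := fun m =>
    (Nat.cast_nonneg _).trans (boundaryCount_le_lim hG hfin hW m 0)
  have hc0 : ∀ m, 0 ≤ c m := fun m => by
    rw [hc, tailCoeff]
    split_ifs
    exacts [hlim0 m, le_rfl]
  set I : ℕ → ENNReal := fun m =>
    ∫⁻ x in Set.Icc (0 : ℝ) 1, ENNReal.ofReal ((x * (1 - x) ^ b) ^ m) with hI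
  have hsum : ∑' m, ENNReal.ofReal (c m) * I m ≠ ⊤ := by
    refine ne_of_eq_of_ne ?_ hint.ne
    rw [lintegral_tsum fun m => by fun_prop]
    refine tsum_congr fun m => ?_
    rw [hI, ← lintegral_const_mul' _ _ ENNReal.ofReal_ne_top]
    simp only [ENNReal.ofReal_mul (hc0 m)]
  have htail := ENNReal.tendsto_sum_nat_add _ hsum
  rw [isTightMeasureSet_iff_exists_isCompact_measure_compl_le]
  intro ε hε
  obtain ⟨M, hM, hLM⟩ := ((htail.eventually_le_const hε).and (eventually_ge_atTop L)).exists
  refine ⟨Set.Icc 0 (M : ℝ), isCompact_Icc, ?_⟩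
  rintro _ ⟨n, rfl⟩
  obtain ⟨x⟩ := (hW.connected n).nonempty
  have htar := exists_mem_targets (T := T) hG ⟨x.1, x.2⟩
  refine (sepSizeLaw_compl_Icc_le _ M).trans (le_trans (ENNReal.tsum_le_tsum fun m => ?_) hM)
  have hLm : L ≤ m + M := by omega
  refine (sum_admissible_le htar hb (hbd n (m + M) hLm)).trans (mul_le_mul_left ?_ _)
  rw [hc, tailCoeff, if_pos hLm, ← ENNReal.ofReal_natCast]
  exact ENNReal.ofReal_le_ofReal (boundaryCount_le_lim hG hfin hW (m + M) n)
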